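/- For an integer $n\ge 2$ let $\mathfrak C_n=\{0,\dots,n-1\}^{\mathbb N}$ be the Cantor space of infinite words (with the product topology), and call a finite set $S$ of finite words over $\{0,\dots,n-1\}$ a prefix code if every $\zeta\in\mathfrak C_n$ has exactly one prefix in $S$. Let $\operatorname{Sym}(n)$ act on $\mathfrak C_n$ letter by letter. For $H\le\operatorname{Sym}(n)$ let $V_n(H)$ be the group, under composition, of all homeomorphisms $f$ of $\mathfrak C_n$ for which there are prefix codes $\{p_1,\dots,p_k\}$ and $\{q_1,\dots,q_k\}$ (each with $k$ distinct elements) and $\sigma_1,\dots,\sigma_k,\tau_1,\dots,\tau_k\in H$ such that $f(p_i\,\sigma_i(u))=q_i\,\tau_i(u)$ for all $i\in\{1,\dots,k\}$ and all $u\in\mathfrak C_n$. Let $2\le m\le n$ be integers with $n\equiv m \pmod{m-1}$, and let $G\le\operatorname{Sym}(m)$. Then there exists a subgroup $H\le\operatorname{Sym}(n)$ such that $V_m(G)$ embeds in $V_n(H)$, that is, there is an injective group homomorphism $V_m(G)\to V_n(H)$. -/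

import Mathlib

namespace SymThompson

/-- The Cantor space `𝔠_n` of infinite words over the alphabet `{0, …, n-1}`, with the product of the
discrete topologies. -/
abbrev Cantor (n : ℕ) : Type := ℕ → Fin n

/-- Concatenation of a finite word with an infinite word. -/
def concat {n : ℕ} (p : List (Fin n)) (u : Cantor n) : Cantor n :=
  fun i => if h : i < p.length then p[i] else u (i - p.length)

/-- The finite word `p` is a prefix of the infinite word `ζ`. -/
def IsPrefixOf {n : ℕ} (p : List (Fin n)) (ζ : Cantor n) : Prop :=
  ∃ u : Cantor n, ζ = concat p u

/-- A (complete) prefix code: a finite set of finite words such that every infinite word has exactly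
one prefix in the set. -/
def IsPrefixCode {n : ℕ} (S : Set (List (Fin n))) : Prop :=
  S.Finite ∧ ∀ ζ : Cantor n, ∃! s, s ∈ S ∧ IsPrefixOf s ζ

/-- A permutation of the alphabet, applied to every letter of an infinite word. -/
def letterwise {n : ℕ} (σ : Equiv.Perm (Fin n)) (u : Cantor n) : Cantor n :=
  fun i => σ (u i)

/-- A table over `H ≤ Sym(n)`: columns `(p_i, σ_i, q_i, τ_i)` such that the `p_i` are distinct and
form a prefix code, likewise the `q_i`, and `σ_i, τ_i ∈ H`. -/
structure Table (n : ℕ) (H : Subgroup (Equiv.Perm (Fin n))) where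
  len : ℕ
  p : Fin len → List (Fin n)
  σ : Fin len → H
  q : Fin len → List (Fin n)
  τ : Fin len → H
  p_injective : Function.Injective p
  q_injective : Function.Injective q
  p_code : IsPrefixCode (Set.range p)
  q_code : IsPrefixCode (Set.range q)

/-- The homeomorphism `f` is the one described by the table `t`:
it sends `p_i σ_i(u)` to `q_i τ_i(u)` for every column `i` and every infinite word `u`. -/
def Table.Describes {n : ℕ} {H : Subgroup (Equiv.Perm (Fin n))} (t : Table n H)
    (f : Cantor n ≃ₜ Cantor n) : Prop :=
  ∀ (i : Fin t.len) (u : Cantor n),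
    f (concat (t.p i) (letterwise (t.σ i : Equiv.Perm (Fin n)) u)) =
      concat (t.q i) (letterwise (t.τ i : Equiv.Perm (Fin n)) u)

/-! ### Facts needed to see that the homeomorphisms described by tables form a group -/

lemma concat_append {n : ℕ} (p w : List (Fin n)) (u : Cantor n) :
    concat (p ++ w) u = concat p (concat w u) := by
  funext i
  simp only [concat, List.length_append, List.getElem_append]
  split_ifs <;> first | rfl | omega | (congr 1; omega)

lemma letterwise_concat {n : ℕ} (σ : Equiv.Perm (Fin n)) (p : List (Fin n)) (u : Cantor n) :
    letterwise σ (concat p u) = concat (p.map σ) (letterwise σ u) := by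
  funext i
  simp only [concat, letterwise, List.length_map, List.getElem_map]
  split_ifs <;> rfl

lemma letterwise_mul {n : ℕ} (σ τ : Equiv.Perm (Fin n)) (u : Cantor n) :
    letterwise (σ * τ) u = letterwise σ (letterwise τ u) := rfl

lemma letterwise_one {n : ℕ} (u : Cantor n) :
    letterwise (1 : Equiv.Perm (Fin n)) u = u := rfl

lemma letterwise_inv_self {n : ℕ} (σ : Equiv.Perm (Fin n)) (u : Cantor n) :
    letterwise σ⁻¹ (letterwise σ u) = u := by
  funext i; simp [letterwise]

lemma letterwise_self_inv {n : ℕ} (σ : Equiv.Perm (Fin n)) (u : Cantor n) :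
    letterwise σ (letterwise σ⁻¹ u) = u := by
  funext i; simp [letterwise]

lemma concat_take {n : ℕ} (N : ℕ) (ζ : Cantor n) :
    concat (List.ofFn fun i : Fin N => ζ i) (fun i => ζ (N + i)) = ζ := by
  funext i
  simp only [concat, List.length_ofFn, List.getElem_ofFn]
  split_ifs
  · rfl
  · congr 1; omega

lemma concat_ofFn_inj {n N : ℕ} {v w : Fin N → Fin n} {x y : Cantor n}
    (h : concat (List.ofFn v) x = concat (List.ofFn w) y) : v = w := by
  funext i
  have := congrFun h i
  simpa [concat] using this

/-- A homeomorphism that acts, on every cone at level `N`, by a prefix replacement followed by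
an element of `H`, is described by a table. -/
lemma exists_table_of_level {n : ℕ} {H : Subgroup (Equiv.Perm (Fin n))} (f : Cantor n ≃ₜ Cantor n)
    (N : ℕ) (hf : ∀ w : Fin N → Fin n, ∃ (q : List (Fin n)) (τ : H), ∀ u : Cantor n,
      f (concat (List.ofFn w) u) = concat q (letterwise (τ : Equiv.Perm (Fin n)) u)) :
    ∃ t : Table n H, t.Describes f := by
  choose q τ h using hf
  have key : ∀ v w : Fin N → Fin n, ∀ x y : Cantor n, concat (q v) x = concat (q w) y → v = w := by
    intro v w x y hxy
    have hv := h v (letterwise (τ v : Equiv.Perm (Fin n))⁻¹ x)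
    have hw := h w (letterwise (τ w : Equiv.Perm (Fin n))⁻¹ y)
    rw [letterwise_self_inv] at hv hw
    exact concat_ofFn_inj (f.injective (hv.trans (hxy.trans hw.symm)))
  have qinj : Function.Injective q := by
    intro v w hvw
    by_contra hne
    obtain ⟨i, -⟩ := Function.ne_iff.1 hne
    exact hne (key v w (fun _ => v i) (fun _ => v i) (by rw [hvw]))
  let e := (Fintype.equivFin (Fin N → Fin n)).symm
  refine ⟨⟨Fintype.card (Fin N → Fin n), fun i => List.ofFn (e i), fun _ => 1, fun i => q (e i),
    fun i => τ (e i), fun i j hij => e.injective (List.ofFn_injective hij),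
    fun i j hij => e.injective (qinj hij), ⟨Set.finite_range _, fun ζ => ?_⟩,
    ⟨Set.finite_range _, fun ζ => ?_⟩⟩, fun i u => h (e i) u⟩
  · refine ⟨List.ofFn fun i : Fin N => ζ i,
      ⟨⟨e.symm fun i : Fin N => ζ i, by simp⟩, _, (concat_take N ζ).symm⟩, ?_⟩
    rintro _ ⟨⟨j, rfl⟩, u, hu⟩
    have := concat_ofFn_inj ((concat_take N ζ).trans hu)
    exact congrArg List.ofFn this.symm
  · obtain ⟨ξ, rfl⟩ := f.surjective ζ
    let w : Fin N → Fin n := fun i => ξ i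
    have hw := h w (fun i => ξ (N + i))
    rw [concat_take] at hw
    refine ⟨q w, ⟨⟨e.symm w, by simp⟩, _, hw⟩, ?_⟩
    rintro _ ⟨⟨j, rfl⟩, u, hu⟩
    exact congrArg q (key _ _ _ _ (hw.symm.trans hu)).symm

/-- A homeomorphism described by a table acts on every sufficiently small cone by a prefix
replacement followed by an element of `H`, and shortens prefixes by a bounded amount. -/
lemma Table.Describes.level {n : ℕ} {H : Subgroup (Equiv.Perm (Fin n))} {t : Table n H}
    {f : Cantor n ≃ₜ Cantor n} (h : t.Describes f) :
    ∃ D : ℕ, ∀ w : List (Fin n), D ≤ w.length → ∃ (q : List (Fin n)) (τ : H),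
      w.length ≤ q.length + D ∧
      ∀ u : Cantor n, f (concat w u) = concat q (letterwise (τ : Equiv.Perm (Fin n)) u) := by
  obtain ⟨D, hD⟩ : ∃ D : ℕ, ∀ i, (t.p i).length ≤ D :=
    ⟨Finset.univ.sup fun i => (t.p i).length, fun i =>
      Finset.le_sup (f := fun i => (t.p i).length) (Finset.mem_univ i)⟩
  refine ⟨D, fun w hw => ?_⟩
  by_cases hn : IsEmpty (Cantor n)
  · exact ⟨w, 1, by omega, fun u => hn.elim u⟩
  rw [not_isEmpty_iff] at hn
  obtain ⟨u₀⟩ := hn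
  obtain ⟨_, ⟨⟨i, rfl⟩, x, hx⟩, -⟩ := t.p_code.2 (concat w u₀)
  have hi : (t.p i).length ≤ w.length := (hD i).trans hw
  have hpre : w = t.p i ++ w.drop (t.p i).length := by
    have : w.take (t.p i).length = t.p i := by
      apply List.ext_getElem
      · simp [hi]
      · intro k h1 h2
        have := congrFun hx k
        simp only [concat, h2, dif_pos, lt_of_lt_of_le h2 hi] at this
        simpa using this
    conv_lhs => rw [← List.take_append_drop (t.p i).length w, this]
  set w' := w.drop (t.p i).length
  refine ⟨t.q i ++ w'.map ((t.τ i * (t.σ i)⁻¹ : H) : Equiv.Perm (Fin n)), t.τ i * (t.σ i)⁻¹, ?_,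
    fun u => ?_⟩
  · have h1 := congrArg List.length hpre
    have h2 := hD i
    simp only [List.length_append, List.length_map] at h1 ⊢
    omega
  · have h1 := h i (letterwise ((t.σ i : Equiv.Perm (Fin n))⁻¹) (concat w' u))
    rw [letterwise_self_inv, ← concat_append, ← hpre, ← letterwise_mul] at h1
    rw [h1, concat_append, ← letterwise_concat]
    rfl

/-- The symmetric Thompson group `V_n(H)`: the group, under composition, of all homeomorphisms of
the Cantor space `𝔠_n` that are described by a table over `H`. -/
def V (n : ℕ) (H : Subgroup (Equiv.Perm (Fin n))) : Subgroup (Cantor n ≃ₜ Cantor n) where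
  carrier := {f | ∃ t : Table n H, t.Describes f}
  one_mem' := exists_table_of_level 1 0 fun w => ⟨List.ofFn w, 1, fun _ => rfl⟩
  mul_mem' := by
    rintro f g ⟨t, ht⟩ ⟨s, hs⟩
    obtain ⟨D, hD⟩ := ht.level
    obtain ⟨E, hE⟩ := hs.level
    refine exists_table_of_level (f * g) (D + E) fun w => ?_
    obtain ⟨q, τ, hq, h1⟩ := hE (List.ofFn w) (by simp)
    obtain ⟨r, ρ, -, h2⟩ := hD q (by simp at hq; omega)
    refine ⟨r, ρ * τ, fun u => ?_⟩
    change f (g _) = _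
    rw [h1, h2]
    rfl
  inv_mem' := by
    rintro f ⟨t, ht⟩
    refine ⟨⟨t.len, t.q, t.τ, t.p, t.σ, t.q_injective, t.p_injective, t.q_code, t.p_code⟩, ?_⟩
    intro i u
    exact (Homeomorph.symm_apply_eq f).2 (ht i u).symm

end SymThompson

/-!
Being in `V n H` is a local condition: near every infinite word the map replaces a prefix and
applies one permutation in `H`, its germ, to all later letters. The embedding is a composition of
two.

Germs form a cocycle with values in `G`, so `V m G` acts on `G × 𝔠_m` by
`f (g, ζ) = (germ f ζ * g, f ζ)`. Placing `(g, ζ)` at `κ g · g⁻¹ ζ`, for distinct words `κ g` of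
equal length, cancels the germs, so that `f` becomes a pure prefix replacement. As no
`κ g` consists of zeros, the image fixes the word `0^∞`.

For the change of alphabet, write `n = m + (m - 1) c`. In the `n`-ary Cantor space, each node `v`
of the `m`-ary tree carries `n - m = (m - 1) c` further cones, which are indexed by pairs of a
nonzero letter `i` and some `l < c`. A pair `(v, i)` is the same thing as the nonzero infinite
word `v i 0^∞`, and prefix replacements fixing `0^∞` permute these words. They thus permute the
further cones, and this action fits together with the one on the `m`-ary words.
-/

namespace SymThompson

open Function

section Words

variable {n : ℕ}

lemma concat_apply_of_lt {p : List (Fin n)} {i : ℕ} (hi : i < p.length) (u : Cantor n) :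
    concat p u i = p[i] := dif_pos hi

lemma concat_length_add (p : List (Fin n)) (u : Cantor n) (i : ℕ) :
    concat p u (p.length + i) = u i := by simp [concat]

lemma concat_injective (p : List (Fin n)) : Injective (concat p) := fun u v h => funext fun i => by
  rw [← concat_length_add p u, h, concat_length_add]

lemma concat_cons_succ (a : Fin n) (p : List (Fin n)) (u : Cantor n) (i : ℕ) :
    concat (a :: p) u (i + 1) = concat p u i := by simp [concat]

lemma concat_cons_inj {a b : Fin n} {p q : List (Fin n)} {u v : Cantor n} :
    concat (a :: p) u = concat (b :: q) v ↔ a = b ∧ concat p u = concat q v := by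
  refine ⟨fun h => ⟨congrFun h 0, funext fun i => ?_⟩, fun ⟨hab, h⟩ => funext fun i => ?_⟩
  · simpa only [concat_cons_succ] using congrFun h (i + 1)
  · cases i with
    | zero => exact hab
    | succ i => simp only [concat_cons_succ, h]

lemma concat_head_tail (ζ : Cantor n) : concat [ζ 0] (fun i => ζ (i + 1)) = ζ := by
  funext i
  cases i <;> rfl

lemma isPrefixOf_iff_getElem {p : List (Fin n)} {ζ : Cantor n} :
    IsPrefixOf p ζ ↔ ∀ (i : ℕ) (hi : i < p.length), ζ i = p[i] := by
  refine ⟨fun ⟨u, hu⟩ i hi => hu ▸ concat_apply_of_lt hi u, fun h =>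
    ⟨fun i => ζ (p.length + i), funext fun i => ?_⟩⟩
  obtain hi | hi := lt_or_ge i p.length
  · rw [concat_apply_of_lt hi, h i hi]
  · obtain ⟨j, rfl⟩ := Nat.exists_eq_add_of_le hi
    rw [concat_length_add]

lemma isPrefixOf_concat (p : List (Fin n)) (u : Cantor n) : IsPrefixOf p (concat p u) := ⟨u, rfl⟩

lemma IsPrefixOf.prefix_of_length_le {p q : List (Fin n)} {ζ : Cantor n} (hp : IsPrefixOf p ζ)
    (hq : IsPrefixOf q ζ) (hle : p.length ≤ q.length) : p <+: q := by
  rw [isPrefixOf_iff_getElem] at hp hq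
  exact List.prefix_iff_getElem.2
    ⟨hle, fun i hi => (hp i hi).symm.trans (hq i (hi.trans_le hle))⟩

lemma letterwise_injective (σ : Equiv.Perm (Fin n)) : Injective (letterwise σ) :=
  LeftInverse.injective (letterwise_inv_self σ)

lemma isOpen_setOf_isPrefixOf (p : List (Fin n)) : IsOpen {ζ : Cantor n | IsPrefixOf p ζ} := by
  have h : {ζ : Cantor n | IsPrefixOf p ζ} =
      ⋂ i : Fin p.length, (fun ζ : Cantor n => ζ i) ⁻¹' {p[i]} := by
    ext ζ
    simp [isPrefixOf_iff_getElem, Fin.forall_iff]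
  rw [h]
  exact isOpen_iInter_of_finite fun i => (isOpen_discrete _).preimage (continuous_apply _)

lemma continuous_concat (p : List (Fin n)) : Continuous (concat p) := by
  refine continuous_pi fun i => ?_
  obtain hi | hi := lt_or_ge i p.length
  · simpa only [concat_apply_of_lt hi] using continuous_const
  · obtain ⟨j, rfl⟩ := Nat.exists_eq_add_of_le hi
    simpa only [concat_length_add] using continuous_apply j

lemma continuous_letterwise (σ : Equiv.Perm (Fin n)) : Continuous (letterwise σ) :=
  continuous_pi fun i => continuous_of_discreteTopology.comp (continuous_apply i)

end Words

section Germ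

variable {n : ℕ} {f g : Cantor n → Cantor n} {p q r : List (Fin n)} {σ τ : Equiv.Perm (Fin n)}
  {ζ : Cantor n}

/-- On the cone of words with prefix `p`, the map `f` replaces `p` by `q` and applies `τ` to every
later letter. -/
def ReplacesPrefix (f : Cantor n → Cantor n) (p q : List (Fin n)) (τ : Equiv.Perm (Fin n)) : Prop :=
  ∀ u, f (concat p u) = concat q (letterwise τ u)

lemma ReplacesPrefix.append (h : ReplacesPrefix f p q τ) (w : List (Fin n)) :
    ReplacesPrefix f (p ++ w) (q ++ w.map τ) τ := fun u => by
  rw [concat_append, h, letterwise_concat, concat_append]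

lemma ReplacesPrefix.comp (hf : ReplacesPrefix f q r σ) (hg : ReplacesPrefix g p q τ) :
    ReplacesPrefix (f ∘ g) p r (σ * τ) := fun u => by
  rw [comp_apply, hg, hf, letterwise_mul]

lemma ReplacesPrefix.inv {f : Equiv.Perm (Cantor n)} (h : ReplacesPrefix f p q τ) :
    ReplacesPrefix (f⁻¹ : Equiv.Perm (Cantor n)) q p τ⁻¹ := fun u =>
  Equiv.Perm.inv_eq_iff_eq.2 (by rw [h, letterwise_self_inv])

lemma ReplacesPrefix.perm_unique (hσ : ReplacesPrefix f p q σ) (hτ : ReplacesPrefix f p r τ) :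
    σ = τ := by
  wlog hle : q.length ≤ r.length generalizing q r σ τ
  · exact (this hτ hσ (le_of_not_ge hle)).symm
  have happly (a : Fin n) : σ a = concat r (letterwise τ fun _ => a) q.length := by
    rw [← hτ, hσ]
    exact (concat_length_add q (letterwise σ fun _ => a) 0).symm
  obtain hlt | heq := hle.lt_or_eq
  · -- `σ` is constant, so the alphabet has at most one letter.
    have hconst (a : Fin n) : σ a = r[q.length] := (happly a).trans (concat_apply_of_lt hlt _)
    exact Equiv.ext fun a =>
      ((hconst a).trans (hconst (σ.symm (τ a))).symm).trans (σ.apply_symm_apply _)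
  · exact Equiv.ext fun a => by
      rw [happly, heq]
      exact concat_length_add r _ 0

/-- Near `ζ`, the map `f` replaces a prefix and applies `τ` to every later letter. -/
def HasGermAt (f : Cantor n → Cantor n) (ζ : Cantor n) (τ : Equiv.Perm (Fin n)) : Prop :=
  ∃ p q, IsPrefixOf p ζ ∧ ReplacesPrefix f p q τ

lemma HasGermAt.exists_le_length (h : HasGermAt f ζ τ) (k : ℕ) :
    ∃ p q, k ≤ p.length ∧ k ≤ q.length ∧ IsPrefixOf p ζ ∧ ReplacesPrefix f p q τ := by
  obtain ⟨p, q, ⟨u, rfl⟩, hf⟩ := h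
  refine ⟨_, _, ?_, ?_, ⟨fun i => u (k + i), ?_⟩, hf.append (List.ofFn fun i : Fin k => u i)⟩
  · simp
  · simp
  · rw [concat_append, concat_take]

lemma hasGermAt_id (ζ : Cantor n) : HasGermAt id ζ 1 := ⟨[], [], ⟨ζ, rfl⟩, fun _ => rfl⟩

lemma HasGermAt.comp (hf : HasGermAt f (g ζ) σ) (hg : HasGermAt g ζ τ) :
    HasGermAt (f ∘ g) ζ (σ * τ) := by
  obtain ⟨q, r, hq, hqr⟩ := hf
  obtain ⟨p, s, -, hle, ⟨u, rfl⟩, hps⟩ := hg.exists_le_length q.length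
  rw [hps u] at hq
  obtain ⟨w, rfl⟩ := hq.prefix_of_length_le (isPrefixOf_concat s _) hle
  exact ⟨p, _, isPrefixOf_concat p u, (hqr.append w).comp hps⟩

lemma HasGermAt.inv {f : Equiv.Perm (Cantor n)} (h : HasGermAt f ζ τ) :
    HasGermAt (f⁻¹ : Equiv.Perm (Cantor n)) (f ζ) τ⁻¹ := by
  obtain ⟨p, q, ⟨u, rfl⟩, hf⟩ := h
  exact ⟨q, p, ⟨_, hf u⟩, hf.inv⟩

lemma HasGermAt.unique (hσ : HasGermAt f ζ σ) (hτ : HasGermAt f ζ τ) : σ = τ := by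
  obtain ⟨p, q, hp, hσ⟩ := hσ
  obtain ⟨p', r, hle, -, hp', hτ⟩ := hτ.exists_le_length p.length
  obtain ⟨w, rfl⟩ := hp.prefix_of_length_le hp' hle
  exact (hσ.append w).perm_unique hτ

lemma HasGermAt.continuousAt (h : HasGermAt f ζ τ) : ContinuousAt f ζ := by
  obtain ⟨p, q, hp, hf⟩ := h
  have hcont : Continuous fun ξ : Cantor n => concat q (letterwise τ fun i => ξ (p.length + i)) :=
    (continuous_concat q).comp <| (continuous_letterwise τ).comp <|
      continuous_pi fun i => continuous_apply _
  refine hcont.continuousAt.congr ?_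
  filter_upwards [(isOpen_setOf_isPrefixOf p).mem_nhds hp]
  rintro _ ⟨u, rfl⟩
  simp only [concat_length_add, hf u]

end Germ

section LocalReplacements

variable {n : ℕ} {H : Subgroup (Equiv.Perm (Fin n))}

/-- The permutations of the Cantor space that have a germ in `H` at every word. They need not be
assumed continuous, and by compactness they form a copy of `V n H`. -/
def localReplacements (n : ℕ) (H : Subgroup (Equiv.Perm (Fin n))) :
    Subgroup (Equiv.Perm (Cantor n)) where
  carrier := {f | ∀ ζ, ∃ τ : H, HasGermAt f ζ τ}
  one_mem' ζ := ⟨1, hasGermAt_id ζ⟩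
  mul_mem' {f g} hf hg ζ := by
    obtain ⟨τ, hτ⟩ := hg ζ
    obtain ⟨σ, hσ⟩ := hf (g ζ)
    exact ⟨σ * τ, hσ.comp hτ⟩
  inv_mem' {f} hf ζ := by
    obtain ⟨τ, hτ⟩ := hf (f⁻¹ ζ)
    exact ⟨τ⁻¹, by simpa using hτ.inv⟩

lemma mem_localReplacements_bot {f : Equiv.Perm (Cantor n)} :
    f ∈ localReplacements n ⊥ ↔ ∀ ζ, HasGermAt f ζ 1 :=
  forall_congr' fun _ => ⟨fun ⟨τ, h⟩ => Subgroup.mem_bot.1 τ.2 ▸ h, fun h => ⟨1, h⟩⟩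

lemma localReplacements_mono : Monotone (localReplacements n) := fun _ _ hHK _ hf ζ =>
  let ⟨τ, h⟩ := hf ζ
  ⟨⟨τ, hHK τ.2⟩, h⟩

lemma continuous_of_mem_localReplacements {f : Equiv.Perm (Cantor n)}
    (hf : f ∈ localReplacements n H) : Continuous f :=
  continuous_iff_continuousAt.2 fun ζ => (hf ζ).choose_spec.continuousAt

lemma exists_level_of_mem_localReplacements {f : Equiv.Perm (Cantor n)}
    (hf : f ∈ localReplacements n H) :
    ∃ N, ∀ w : List (Fin n), N < w.length → ∃ q, ∃ τ : H, ReplacesPrefix f w q τ := by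
  choose τ p q hp h using hf
  obtain ⟨s, hs⟩ := isCompact_univ.elim_finite_subcover _ (fun ζ => isOpen_setOf_isPrefixOf (p ζ))
    fun ζ _ => Set.mem_iUnion.2 ⟨ζ, hp ζ⟩
  refine ⟨s.sup fun ζ => (p ζ).length, fun w hw => ?_⟩
  have hpos : 0 < w.length := Nat.zero_lt_of_lt hw
  obtain ⟨ζ, hζ, hpw⟩ := Set.mem_iUnion₂.1 (hs (Set.mem_univ (concat w fun _ => w[0])))
  have hle : (p ζ).length ≤ w.length :=
    (Finset.le_sup (f := fun ζ => (p ζ).length) hζ).trans hw.le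
  obtain ⟨v, rfl⟩ := hpw.prefix_of_length_le (isPrefixOf_concat w _) hle
  exact ⟨_, τ ζ, (h ζ).append v⟩

lemma mem_V_iff {f : Cantor n ≃ₜ Cantor n} :
    f ∈ V n H ↔ f.toEquiv ∈ localReplacements n H := by
  refine ⟨fun ⟨t, ht⟩ ζ => ?_, fun hf => ?_⟩
  · obtain ⟨D, hD⟩ := ht.level
    obtain ⟨q, τ, -, h⟩ := hD (List.ofFn fun i : Fin D => ζ i) (by simp)
    exact ⟨τ, _, q, ⟨_, (concat_take D ζ).symm⟩, h⟩
  · obtain ⟨N, hN⟩ := exists_level_of_mem_localReplacements hf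
    exact exists_table_of_level f (N + 1) fun w => hN (List.ofFn w) (by simp)

/-- Forgetting continuity identifies the symmetric Thompson group with the group of local
replacements. -/
def V.equivLocalReplacements (n : ℕ) (H : Subgroup (Equiv.Perm (Fin n))) :
    V n H ≃* localReplacements n H where
  toFun f := ⟨f.1.toEquiv, mem_V_iff.1 f.2⟩
  invFun f :=
    ⟨(continuous_of_mem_localReplacements f.2).homeoOfEquivCompactToT2, mem_V_iff.2 f.2⟩
  left_inv _ := rfl
  right_inv _ := rfl
  map_mul' _ _ := rfl

end LocalReplacements

section SkewProduct

variable {m : ℕ} {G : Subgroup (Equiv.Perm (Fin m))}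

/-- The element of `G` that `f` applies to the tails of the words near `ζ`. -/
noncomputable def germ (f : localReplacements m G) (ζ : Cantor m) : G := (f.2 ζ).choose

lemma hasGermAt_germ (f : localReplacements m G) (ζ : Cantor m) : HasGermAt f.1 ζ (germ f ζ) :=
  (f.2 ζ).choose_spec

lemma germ_eq {f : localReplacements m G} {ζ : Cantor m} {τ : G} (h : HasGermAt f.1 ζ τ) :
    germ f ζ = τ :=
  Subtype.ext ((hasGermAt_germ f ζ).unique h)

lemma germ_one (ζ : Cantor m) : germ (1 : localReplacements m G) ζ = 1 :=
  germ_eq (hasGermAt_id ζ)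

lemma germ_mul (f g : localReplacements m G) (ζ : Cantor m) :
    germ (f * g) ζ = germ f (g.1 ζ) * germ g ζ :=
  germ_eq ((hasGermAt_germ f _).comp (hasGermAt_germ g ζ))

/-- The action of the local replacements on `G × 𝔠_m` in which the germ cocycle drives the first
coordinate. -/
noncomputable def skewProduct (G : Subgroup (Equiv.Perm (Fin m))) :
    localReplacements m G →* Equiv.Perm (G × Cantor m) :=
  letI : MulAction (localReplacements m G) (G × Cantor m) :=
    { smul := fun f x => (germ f x.2 * x.1, f.1 x.2)
      one_smul := fun x => Prod.ext ((congrArg (· * x.1) (germ_one x.2)).trans (one_mul _)) rfl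
      mul_smul := fun f g x =>
        Prod.ext ((congrArg (· * x.1) (germ_mul f g x.2)).trans (mul_assoc _ _ _)) rfl }
  MulAction.toPermHom _ _

lemma skewProduct_injective : Injective (skewProduct G) := fun _ _ h =>
  Subtype.ext (Equiv.ext fun ζ => congrArg Prod.snd (Equiv.congr_fun h (1, ζ)))

variable {L : ℕ} {κ : G → Fin L → Fin m}

/-- The copy of the Cantor space with index `g` is placed on the cone with prefix `κ g`. The letters
are twisted by `g⁻¹`, which cancels the germs of the skew product. -/
def twistedCone (κ : G → Fin L → Fin m) (x : G × Cantor m) : Cantor m :=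
  concat (List.ofFn (κ x.1)) (letterwise (x.1⁻¹ : Equiv.Perm (Fin m)) x.2)

lemma twistedCone_injective (hκ : Injective κ) : Injective (twistedCone κ) := by
  rintro ⟨g, ζ⟩ ⟨g', ζ'⟩ h
  obtain rfl : g = g' := hκ (concat_ofFn_inj h)
  exact congrArg _ (letterwise_injective _ (concat_injective _ h))

/-- The skew product, moved into the Cantor space along the twisted cones and extended by the
identity. -/
noncomputable def untwist (hκ : Injective κ) : localReplacements m G →* Equiv.Perm (Cantor m) :=
  (Equiv.Perm.viaEmbeddingHom ⟨twistedCone κ, twistedCone_injective hκ⟩).comp (skewProduct G)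

lemma untwist_injective (hκ : Injective κ) : Injective (untwist hκ) :=
  (Equiv.Perm.viaEmbeddingHom_injective _).comp skewProduct_injective

lemma untwist_twistedCone (hκ : Injective κ) (f : localReplacements m G) (x : G × Cantor m) :
    untwist hκ f (twistedCone κ x) = twistedCone κ (germ f x.2 * x.1, f.1 x.2) :=
  Equiv.Perm.viaEmbedding_apply _ ⟨twistedCone κ, twistedCone_injective hκ⟩ x

lemma untwist_of_notMem_range (hκ : Injective κ) (f : localReplacements m G) {ξ : Cantor m}
    (hξ : ξ ∉ Set.range (twistedCone κ)) : untwist hκ f ξ = ξ :=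
  Equiv.Perm.viaEmbedding_apply_of_notMem _ ⟨twistedCone κ, twistedCone_injective hκ⟩ ξ hξ

lemma concat_ofFn_mem_range_twistedCone {v : Fin L → Fin m} {u : Cantor m} :
    concat (List.ofFn v) u ∈ Set.range (twistedCone κ) ↔ v ∈ Set.range κ := by
  refine ⟨fun ⟨x, hx⟩ => ⟨x.1, concat_ofFn_inj hx⟩, ?_⟩
  rintro ⟨g, rfl⟩
  exact ⟨(g, letterwise (g : Equiv.Perm (Fin m)) u), by
    simp only [twistedCone, letterwise_inv_self]⟩

lemma hasGermAt_untwist_twistedCone (hκ : Injective κ) (f : localReplacements m G)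
    (x : G × Cantor m) : HasGermAt (untwist hκ f) (twistedCone κ x) 1 := by
  obtain ⟨g, ζ⟩ := x
  obtain ⟨p, q, ⟨z, rfl⟩, h⟩ := hasGermAt_germ f ζ
  set τ := germ f (concat p z)
  have hgerm (u : Cantor m) : germ f (concat p u) = τ := germ_eq ⟨p, q, isPrefixOf_concat p u, h⟩
  refine ⟨List.ofFn (κ g) ++ p.map (g⁻¹ : Equiv.Perm (Fin m)),
    List.ofFn (κ (τ * g)) ++ q.map ((τ * g : G)⁻¹ : Equiv.Perm (Fin m)),
    ⟨letterwise (g⁻¹ : Equiv.Perm (Fin m)) z, ?_⟩, fun u => ?_⟩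
  · simp only [twistedCone, letterwise_concat, concat_append]
  calc untwist hκ f (concat (List.ofFn (κ g) ++ p.map (g⁻¹ : Equiv.Perm (Fin m))) u)
      = untwist hκ f (twistedCone κ (g, concat p (letterwise (g : Equiv.Perm (Fin m)) u))) := by
        simp only [twistedCone, letterwise_concat, letterwise_inv_self, concat_append]
    _ = twistedCone κ (τ * g, concat q (letterwise ((τ * g : G) : Equiv.Perm (Fin m)) u)) := by
        rw [untwist_twistedCone, hgerm, h, ← letterwise_mul]
        rfl
    _ = concat (List.ofFn (κ (τ * g)) ++ q.map ((τ * g : G)⁻¹ : Equiv.Perm (Fin m))) u := by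
        simp only [twistedCone, letterwise_concat, letterwise_inv_self, concat_append]

lemma hasGermAt_untwist_of_notMem_range (hκ : Injective κ) (f : localReplacements m G)
    {ξ : Cantor m} (hξ : ξ ∉ Set.range (twistedCone κ)) : HasGermAt (untwist hκ f) ξ 1 := by
  rw [← concat_take L ξ, concat_ofFn_mem_range_twistedCone] at hξ
  exact ⟨_, _, ⟨_, (concat_take L ξ).symm⟩, fun u =>
    untwist_of_notMem_range hκ f (concat_ofFn_mem_range_twistedCone.not.2 hξ)⟩

lemma untwist_mem_localReplacements_bot (hκ : Injective κ) (f : localReplacements m G) :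
    untwist hκ f ∈ localReplacements m ⊥ := by
  refine mem_localReplacements_bot.2 fun ξ => ?_
  by_cases hξ : ξ ∈ Set.range (twistedCone κ)
  · obtain ⟨x, rfl⟩ := hξ
    exact hasGermAt_untwist_twistedCone hκ f x
  · exact hasGermAt_untwist_of_notMem_range hκ f hξ

/-- The local prefix replacements that fix the zero word. -/
def pointedReplacements (m : ℕ) [NeZero m] : Subgroup (Equiv.Perm (Cantor m)) :=
  localReplacements m ⊥ ⊓ MulAction.stabilizer (Equiv.Perm (Cantor m)) (0 : Cantor m)

lemma exists_injective_ne_zero [NeZero m] (hm : 2 ≤ m) (α : Type*) [Finite α] :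
    ∃ (L : ℕ) (κ : α → Fin L → Fin m), Injective κ ∧ ∀ a, κ a ≠ 0 := by
  classical
  have := Fintype.ofFinite α
  let L := Fintype.card α
  have hcard : Fintype.card α ≤ Fintype.card {w : Fin L → Fin m // w ≠ 0} := by
    have hpow : L < m ^ L := Nat.lt_pow_self hm
    have hcompl : Fintype.card {w : Fin L → Fin m // w ≠ 0} = m ^ L - 1 := by
      simp [Fintype.card_subtype_compl]
    omega
  obtain ⟨e⟩ := Embedding.nonempty_of_card_le hcard
  exact ⟨L, fun a => (e a).1, Subtype.val_injective.comp e.injective, fun a => (e a).2⟩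

lemma exists_injective_hom_pointedReplacements [NeZero m] (hm : 2 ≤ m)
    (G : Subgroup (Equiv.Perm (Fin m))) :
    ∃ φ : localReplacements m G →* pointedReplacements m, Injective φ := by
  obtain ⟨L, κ, hκ, hκ0⟩ := exists_injective_ne_zero hm G
  have hzero : (0 : Cantor m) ∉ Set.range (twistedCone κ) := by
    rw [← concat_take L (0 : Cantor m), concat_ofFn_mem_range_twistedCone]
    exact fun ⟨g, hg⟩ => hκ0 g hg
  exact ⟨(untwist hκ).codRestrict _ fun f =>
      ⟨untwist_mem_localReplacements_bot hκ f, untwist_of_notMem_range hκ f hzero⟩,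
    (MonoidHom.injective_codRestrict _ _ _).2 (untwist_injective hκ)⟩

end SkewProduct

section ReducedWord

variable {m : ℕ} [NeZero m]

/-- A nonempty finite word with nonzero last letter, which is kept separate from the others. -/
abbrev ReducedWord (m : ℕ) [NeZero m] : Type := List (Fin m) × {i : Fin m // i ≠ 0}

/-- The infinite word that continues a reduced word by zeros. -/
def ReducedWord.padded (w : ReducedWord m) : Cantor m := concat (w.1 ++ [w.2.1]) 0

lemma concat_singleton_zero : concat [(0 : Fin m)] 0 = 0 := concat_head_tail 0

lemma eq_zero_of_concat_eq_zero {p : List (Fin m)} {u : Cantor m} (h : concat p u = 0) : u = 0 :=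
  funext fun i => (concat_length_add p u i).symm.trans (congrFun h _)

lemma ReducedWord.padded_ne_zero (w : ReducedWord m) : w.padded ≠ 0 := fun h => by
  rw [padded, concat_append] at h
  exact w.2.2 (congrFun (eq_zero_of_concat_eq_zero h) 0)

lemma ReducedWord.padded_injective : Injective (padded (m := m)) := by
  rintro ⟨v, i⟩ ⟨v', i'⟩ h
  induction v generalizing v' with
  | nil =>
    cases v' with
    | nil => exact Prod.ext rfl (Subtype.ext (concat_cons_inj.1 h).1)
    | cons b v' => exact absurd (concat_cons_inj.1 h).2.symm (padded_ne_zero (v', i'))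
  | cons a v ih =>
    cases v' with
    | nil => exact absurd (concat_cons_inj.1 h).2 (padded_ne_zero (v, i))
    | cons b v' =>
      obtain ⟨rfl, htail⟩ := concat_cons_inj.1 h
      obtain ⟨rfl, rfl⟩ := Prod.mk.inj (ih v' htail)
      rfl

lemma ReducedWord.exists_padded_eq_concat_zero (p : List (Fin m)) (hp : concat p 0 ≠ 0) :
    ∃ w : ReducedWord m, w.padded = concat p 0 := by
  induction p using List.reverseRecOn with
  | nil => exact absurd rfl hp
  | append_singleton p a ih =>
    by_cases ha : a = 0
    · rw [ha, concat_append, concat_singleton_zero] at hp ⊢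
      exact ih hp
    · exact ⟨(p, ⟨a, ha⟩), rfl⟩

lemma HasGermAt.exists_eq_concat_zero {f : Cantor m → Cantor m} {p : List (Fin m)}
    (hf : HasGermAt f (concat p 0) 1) : ∃ q, f (concat p 0) = concat q 0 := by
  obtain ⟨p', q, hle, -, hp', hf⟩ := hf.exists_le_length p.length
  obtain ⟨w, rfl⟩ := (isPrefixOf_concat p 0).prefix_of_length_le hp' hle
  obtain ⟨u, hu⟩ := hp'
  have hu0 : u = 0 := by
    rw [concat_append] at hu
    exact eq_zero_of_concat_eq_zero (concat_injective p hu).symm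
  exact ⟨q, by rw [hu, hf, hu0]; rfl⟩

variable (m) in
/-- The words `ReducedWord.padded w`, that is, the nonzero infinite words with finitely many nonzero
letters, as a set on which the pointed local replacements act. -/
def nonzeroFinSupp : SubMulAction (pointedReplacements m) (Cantor m) where
  carrier := Set.range ReducedWord.padded
  smul_mem' := by
    rintro f _ ⟨w, rfl⟩
    obtain ⟨q, hq⟩ : ∃ q, f.1 w.padded = concat q 0 :=
      (mem_localReplacements_bot.1 f.2.1 w.padded).exists_eq_concat_zero
    have hne : f.1 w.padded ≠ 0 := fun h =>
      w.padded_ne_zero (f.1.injective (h.trans (MulAction.mem_stabilizer_iff.1 f.2.2).symm))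
    obtain ⟨w', hw'⟩ := ReducedWord.exists_padded_eq_concat_zero q (hq ▸ hne)
    exact ⟨w', hw'.trans hq.symm⟩

variable (m) in
/-- The action of the pointed local replacements on nonzero words of finite support, read on reduced
words. -/
noncomputable def reducedWordHom : pointedReplacements m →* Equiv.Perm (ReducedWord m) :=
  (Equiv.ofInjective _ ReducedWord.padded_injective).symm.permCongrHom.toMonoidHom.comp
    (MulAction.toPermHom (pointedReplacements m) (nonzeroFinSupp m))

lemma padded_reducedWordHom (f : pointedReplacements m) (w : ReducedWord m) :
    (reducedWordHom m f w).padded = f.1 w.padded :=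
  congrArg Subtype.val <|
    (Equiv.ofInjective _ ReducedWord.padded_injective).apply_symm_apply
      (f • (⟨w.padded, w, rfl⟩ : nonzeroFinSupp m))

lemma reducedWordHom_append (f : pointedReplacements m) {p q : List (Fin m)}
    (h : ReplacesPrefix f.1 p q 1) (v : List (Fin m)) (i : {i : Fin m // i ≠ 0}) :
    reducedWordHom m f (p ++ v, i) = (q ++ v, i) := by
  refine ReducedWord.padded_injective ?_
  rw [padded_reducedWordHom]
  simp only [ReducedWord.padded, List.append_assoc, concat_append p, concat_append q]
  rw [h, letterwise_one]

end ReducedWord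

section ChangeOfAlphabet

variable {m n c : ℕ} [NeZero m]

/-- The Cantor space over `m` letters together with `c` cones over `n` letters for each reduced
word. -/
abbrev Blowup (m n c : ℕ) [NeZero m] : Type := Cantor m ⊕ ReducedWord m × Fin c × Cantor n

variable (m n c) in
/-- The action of the pointed local replacements on the blowup, which permutes the cones as it
permutes reduced words. -/
noncomputable def blowupHom : pointedReplacements m →* Equiv.Perm (Blowup m n c) :=
  MonoidHom.mk' (fun f => Equiv.sumCongr f.1 ((reducedWordHom m f).prodCongr (Equiv.refl _)))
    fun f g => by ext (ζ | ⟨w, y⟩) : 1 <;> simp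

lemma blowupHom_injective : Injective (blowupHom m n c) := fun _ _ h =>
  Subtype.ext (Equiv.ext fun ζ => Sum.inl_injective (Equiv.congr_fun h (Sum.inl ζ)))

/-- Prefixing `p` to a point of the blowup, that is, to its infinite word over `m` letters or to its
reduced word. -/
def Blowup.prepend (p : List (Fin m)) : Blowup m n c → Blowup m n c :=
  Sum.map (concat p) (Prod.map (Prod.map (p ++ ·) id) id)

lemma blowupHom_prepend (f : pointedReplacements m) {p q : List (Fin m)}
    (h : ReplacesPrefix f.1 p q 1) (z : Blowup m n c) :
    blowupHom m n c f (z.prepend p) = z.prepend q := by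
  obtain ζ | ⟨⟨v, i⟩, y⟩ := z
  · exact congrArg Sum.inl (h ζ)
  · exact congrArg (fun w => Sum.inr (w, y)) (reducedWordHom_append f h v i)

variable (A : Fin m ⊕ {i : Fin m // i ≠ 0} × Fin c ≃ Fin n)

/-- The word over `n` letters that encodes the reduced word `w` and the index `l` of one of its `c`
cones: its last letter is a new one, which records both the last letter of `w` and `l`. -/
def ReducedWord.code (w : ReducedWord m) (l : Fin c) : List (Fin n) :=
  w.1.map (A ∘ Sum.inl) ++ [A (Sum.inr (w.2, l))]

/-- The coding of the blowup by infinite words over `n` letters: `m` letters are copies of the old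
ones, and the first of the `n - m` new letters marks the end of a reduced word. -/
def blowupCode : Blowup m n c → Cantor n
  | Sum.inl ζ => A ∘ Sum.inl ∘ ζ
  | Sum.inr (w, l, t) => concat (w.code A l) t

lemma blowupCode_prepend (p : List (Fin m)) (z : Blowup m n c) :
    blowupCode A (z.prepend p) = concat (p.map (A ∘ Sum.inl)) (blowupCode A z) := by
  obtain ζ | ⟨⟨v, i⟩, l, t⟩ := z
  · funext k
    simp only [Blowup.prepend, Sum.map_inl, blowupCode, concat, comp_apply, List.length_map,
      List.getElem_map]
    split_ifs <;> rfl
  · simp only [Blowup.prepend, Sum.map_inr, Prod.map_apply, id_eq, blowupCode, ReducedWord.code,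
      List.map_append, List.append_assoc, concat_append]

lemma blowupCode_inr_ne_inl (w : ReducedWord m) (y : Fin c × Cantor n) (ζ : Cantor m) :
    blowupCode A (Sum.inr (w, y)) ≠ blowupCode A (Sum.inl ζ) := fun h => by
  have hlast := congrFun h (w.1.map (A ∘ Sum.inl)).length
  simp [blowupCode, ReducedWord.code, concat] at hlast

lemma blowupCode_inr_injective :
    Injective fun z : ReducedWord m × Fin c × Cantor n => blowupCode A (Sum.inr z) := by
  rintro ⟨⟨v, i⟩, l, t⟩ ⟨⟨v', i'⟩, l', t'⟩ h
  induction v generalizing v' with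
  | nil =>
    cases v' with
    | nil =>
      obtain ⟨hletter, htail⟩ := concat_cons_inj.1 h
      obtain ⟨rfl, rfl⟩ := Prod.mk.inj (Sum.inr_injective (A.injective hletter))
      obtain rfl : t = t' := htail
      rfl
    | cons b v' => cases A.injective (concat_cons_inj.1 h).1
  | cons a v ih =>
    cases v' with
    | nil => cases A.injective (concat_cons_inj.1 h).1
    | cons b v' =>
      obtain ⟨hletter, htail⟩ := concat_cons_inj.1 h
      obtain rfl := Sum.inl_injective (A.injective hletter)
      cases ih v' htail
      rfl

lemma blowupCode_injective : Injective (blowupCode A) := by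
  rintro (ζ | z) (ζ' | z') h
  · exact congrArg Sum.inl ((A.injective.comp Sum.inl_injective).comp_left h)
  · exact absurd h.symm (blowupCode_inr_ne_inl A _ _ ζ)
  · exact absurd h (blowupCode_inr_ne_inl A _ _ ζ')
  · exact congrArg Sum.inr (blowupCode_inr_injective A h)

lemma mem_range_blowupCode_of_letter (k : ℕ) (ξ : Cantor n) (x : {i : Fin m // i ≠ 0} × Fin c)
    (hk : ξ k = A (Sum.inr x)) : ξ ∈ Set.range (blowupCode A) := by
  rw [← concat_head_tail ξ]
  obtain ⟨b | y, hb⟩ := A.surjective (ξ 0)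
  · cases k with
    | zero => cases A.injective (hb.trans hk)
    | succ k =>
      obtain ⟨z, hz⟩ := mem_range_blowupCode_of_letter k (fun i => ξ (i + 1)) x hk
      exact ⟨z.prepend [b], by rw [blowupCode_prepend, hz, ← hb]; rfl⟩
  · exact ⟨Sum.inr (([], y.1), y.2, fun i => ξ (i + 1)), by rw [← hb]; rfl⟩

lemma blowupCode_surjective : Surjective (blowupCode A) := fun ξ => by
  by_cases h : ∃ k x, ξ k = A (Sum.inr x)
  · obtain ⟨k, x, hk⟩ := h
    exact mem_range_blowupCode_of_letter A k ξ x hk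
  · have hold (k : ℕ) : ∃ a, A (Sum.inl a) = ξ k := by
      obtain ⟨a | x, hx⟩ := A.surjective (ξ k)
      · exact ⟨a, hx⟩
      · exact absurd ⟨k, x, hx.symm⟩ h
    choose ζ hζ using hold
    exact ⟨Sum.inl ζ, funext hζ⟩

/-- The identification of the blowup with the Cantor space over `n` letters. -/
noncomputable def blowupEquiv : Blowup m n c ≃ Cantor n :=
  Equiv.ofBijective (blowupCode A) ⟨blowupCode_injective A, blowupCode_surjective A⟩

/-- The action of the pointed local replacements on infinite words over `n` letters, read off from
the blowup. -/
noncomputable def changeAlphabet : pointedReplacements m →* Equiv.Perm (Cantor n) :=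
  (blowupEquiv A).permCongrHom.toMonoidHom.comp (blowupHom m n c)

lemma changeAlphabet_injective : Injective (changeAlphabet A) :=
  (blowupEquiv A).permCongrHom.injective.comp blowupHom_injective

lemma changeAlphabet_blowupCode (f : pointedReplacements m) (z : Blowup m n c) :
    changeAlphabet A f (blowupCode A z) = blowupCode A (blowupHom m n c f z) :=
  congrArg (fun z => blowupCode A (blowupHom m n c f z))
    ((blowupEquiv A).symm_apply_apply z)

lemma changeAlphabet_mem_localReplacements_bot (f : pointedReplacements m) :
    changeAlphabet A f ∈ localReplacements n ⊥ := by
  refine mem_localReplacements_bot.2 fun ξ => ?_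
  obtain ⟨ζ | ⟨w, l, t⟩, rfl⟩ := blowupCode_surjective A ξ
  · obtain ⟨p, q, ⟨u, rfl⟩, h⟩ := mem_localReplacements_bot.1 f.2.1 ζ
    refine ⟨p.map (A ∘ Sum.inl), q.map (A ∘ Sum.inl),
      ⟨_, blowupCode_prepend A p (Sum.inl u)⟩, fun ξ => ?_⟩
    obtain ⟨z, rfl⟩ := blowupCode_surjective A ξ
    rw [← blowupCode_prepend, changeAlphabet_blowupCode, blowupHom_prepend f h,
      blowupCode_prepend, letterwise_one]
  · exact ⟨w.code A l, (reducedWordHom m f w).code A l, isPrefixOf_concat _ t, fun u =>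
      changeAlphabet_blowupCode A f (Sum.inr (w, l, u))⟩

lemma nonempty_alphabet_equiv (h : n = m + (m - 1) * c) :
    Nonempty (Fin m ⊕ {i : Fin m // i ≠ 0} × Fin c ≃ Fin n) := by
  classical
  refine ⟨Fintype.equivOfCardEq ?_⟩
  simp [Fintype.card_subtype_compl, h]

lemma exists_injective_hom_localReplacements (hmn : m ≤ n) (hmod : n ≡ m [MOD (m - 1)])
    (H : Subgroup (Equiv.Perm (Fin n))) :
    ∃ ψ : pointedReplacements m →* localReplacements n H, Injective ψ := by
  obtain ⟨c, hc⟩ := (Nat.modEq_iff_dvd' hmn).1 hmod.symm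
  obtain ⟨A⟩ := nonempty_alphabet_equiv (m := m) (n := n) (c := c) (by omega)
  exact ⟨(changeAlphabet A).codRestrict _ fun f =>
      localReplacements_mono bot_le (changeAlphabet_mem_localReplacements_bot A f),
    (MonoidHom.injective_codRestrict _ _ _).2 (changeAlphabet_injective A)⟩

end ChangeOfAlphabet

end SymThompson

open SymThompson in
theorem mainTheorem3_general (m n : ℕ) (hm : 2 ≤ m) (hmn : m ≤ n) (hmod : n ≡ m [MOD (m - 1)])
    (G : Subgroup (Equiv.Perm (Fin m))) (H : Subgroup (Equiv.Perm (Fin n))) :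
    ∃ ι : V m G →* V n H, Function.Injective ι := by
  have : NeZero m := ⟨by omega⟩
  obtain ⟨φ, hφ⟩ := exists_injective_hom_pointedReplacements hm G
  obtain ⟨ψ, hψ⟩ := exists_injective_hom_localReplacements hmn hmod H
  let eG := V.equivLocalReplacements m G
  let eH := V.equivLocalReplacements n H
  exact ⟨eH.symm.toMonoidHom.comp ((ψ.comp φ).comp eG.toMonoidHom),
    eH.symm.injective.comp ((hψ.comp hφ).comp eG.injective)⟩

theorem mainTheorem3 (m n : ℕ) (hm : 2 ≤ m) (hmn : m ≤ n) (hmod : n ≡ m [MOD (m - 1)])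
    (G : Subgroup (Equiv.Perm (Fin m))) :
    ∃ H : Subgroup (Equiv.Perm (Fin n)),
      ∃ ι : SymThompson.V m G →* SymThompson.V n H, Function.Injective ι :=
  ⟨⊥, mainTheorem3_general m n hm hmn hmod G ⊥⟩
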